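/- Let $d \ge 1$ be an integer, let $\nu > d-1$ be real and let $\Psi$ be a positive definite real $d \times d$ matrix. Let $G = \mathrm{IW}(\nu,\Psi)$ be the inverse-Wishart distribution with $\nu$ degrees of freedom and scale matrix $\Psi$, i.e. the law of $\Sigma = W^{-1}$ where $W$ has the Wishart distribution with $\nu$ degrees of freedom and scale matrix $\Psi^{-1}$. Write $\mathrm{eig}_1(A) \le \cdots \le \mathrm{eig}_d(A)$ for the eigenvalues of a symmetric matrix $A$. Then: (i) there are constants $a_2, b_2, C_2 > 0$ such that, for all sufficiently large $x > 0$, $$G\{\Sigma : \mathrm{eig}_d(\Sigma^{-1}) \ge x\} \le b_2 \exp(-C_2 x^{a_2});$$ (ii) there are constants $a_3, b_3 > 0$ such that, for all sufficiently small $x > 0$, $$G\{\Sigma : \mathrm{eig}_1(\Sigma^{-1}) < x\} \le b_3 x^{a_3};$$ (iii) with $\kappa = 2$, there are constants $a_4, a_5, b_4, C_3 > 0$ such that, for all $0 < s_1 \le \cdots \le s_d$ and all $t \in (0,1)$, $$G\{\Sigma : s_j < \mathrm{eig}_j(\Sigma^{-1}) < s_j(1+t),\ j = 1,\ldots,d\}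 \ge b_4\, s_1^{a_4}\, t^{a_5} \exp(-C_3 s_d^{\kappa/2}).$$ -/

import Mathlib

open Filter Topology MeasureTheory

noncomputable section

/-- Square real matrices carry the Borel σ-algebra, that is, the product one. -/
instance instMeasurableSpaceSqMatrix {d : ℕ} : MeasurableSpace (Matrix (Fin d) (Fin d) ℝ) :=
  inferInstanceAs (MeasurableSpace (Fin d → Fin d → ℝ))

instance instBorelSpaceSqMatrix {d : ℕ} : BorelSpace (Matrix (Fin d) (Fin d) ℝ) :=
  inferInstanceAs (BorelSpace (Fin d → Fin d → ℝ))

/-- The symmetric `d × d` matrix whose entries on and above the diagonal are given by `u`. -/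
def symOfUpper {d : ℕ} (u : {p : Fin d × Fin d // p.1 ≤ p.2} → ℝ) : Matrix (Fin d) (Fin d) ℝ :=
  Matrix.of fun i j => u ⟨(min i j, max i j), min_le_max⟩

/-- Lebesgue measure `∏_{i ≤ j} dw_{ij}` on the symmetric `d × d` matrices, as a measure on all
`d × d` matrices. -/
def symLebesgue (d : ℕ) : Measure (Matrix (Fin d) (Fin d) ℝ) :=
  Measure.map symOfUpper (volume : Measure ({p : Fin d × Fin d // p.1 ≤ p.2} → ℝ))

/-- The multivariate gamma function `Γ_d(a) = π^{d(d-1)/4} ∏_{j=1}^d Γ(a - (j-1)/2)`. -/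
def multiGamma (d : ℕ) (a : ℝ) : ℝ :=
  Real.pi ^ ((d : ℝ) * ((d : ℝ) - 1) / 4) * ∏ j : Fin d, Real.Gamma (a - (j : ℝ) / 2)

open Classical in
/-- The Wishart density with `ν` degrees of freedom and scale matrix `V`; it lives on the
positive definite matrices. -/
def wishartDensity {d : ℕ} (ν : ℝ) (V W : Matrix (Fin d) (Fin d) ℝ) : ℝ :=
  if W.PosDef then
    W.det ^ ((ν - (d : ℝ) - 1) / 2) * Real.exp (-(V⁻¹ * W).trace / 2) /
      ((2 : ℝ) ^ (ν * (d : ℝ) / 2) * V.det ^ (ν / 2) * multiGamma d (ν / 2))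
  else 0

/-- The Wishart distribution `W_d(ν, V)`, for `V` positive definite and real `ν > d - 1`. -/
def wishart {d : ℕ} (ν : ℝ) (V : Matrix (Fin d) (Fin d) ℝ) : Measure (Matrix (Fin d) (Fin d) ℝ) :=
  (symLebesgue d).withDensity fun W => ENNReal.ofReal (wishartDensity ν V W)

/-- The inverse-Wishart distribution `IW(ν, Ψ)`: the law of `W⁻¹` for `W ∼ W_d(ν, Ψ⁻¹)`. -/
def invWishart {d : ℕ} (ν : ℝ) (Ψ : Matrix (Fin d) (Fin d) ℝ) :
    Measure (Matrix (Fin d) (Fin d) ℝ) :=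
  (wishart ν Ψ⁻¹).map fun W => W⁻¹

/-- Together with the next fact: `Measure.map` is applied above to measurable maps only. -/
theorem measurable_symOfUpper {d : ℕ} : Measurable (symOfUpper (d := d)) := by
  refine measurable_pi_iff.2 fun i => measurable_pi_iff.2 fun j => ?_
  exact measurable_pi_apply _

theorem measurable_matrix_inv {d : ℕ} :
    Measurable fun W : Matrix (Fin d) (Fin d) ℝ => W⁻¹ := by
  have hdet : Continuous fun W : Matrix (Fin d) (Fin d) ℝ => W.det := continuous_id.matrix_det
  have hadj : Continuous fun W : Matrix (Fin d) (Fin d) ℝ => W.adjugate :=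
    continuous_id.matrix_adjugate
  refine measurable_pi_iff.2 fun i => measurable_pi_iff.2 fun j => ?_
  have h : (fun W : Matrix (Fin d) (Fin d) ℝ => W⁻¹ i j) =
      fun W => (W.det)⁻¹ * W.adjugate i j := by
    funext W
    simp [Matrix.inv_def, Matrix.smul_apply]
  rw [h]
  exact hdet.measurable.inv.mul
    ((continuous_apply j).comp ((continuous_apply i).comp hadj)).measurable

/-- The eigenvalues `eig_1(A) ≤ ⋯ ≤ eig_d(A)` of a symmetric matrix `A`, with multiplicity and in
increasing order; the index `j : Fin d` counts from `0`. (Matrices that are not symmetric get the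
value `0`; they do not matter below.) -/
def eig {d : ℕ} (A : Matrix (Fin d) (Fin d) ℝ) (j : Fin d) : ℝ :=
  open Classical in
  if h : A.IsHermitian then h.eigenvalues₀ (Fin.cast (Fintype.card_fin d).symm j.rev) else 0

/-- Exponential tail of the largest eigenvalue of `Σ⁻¹` under `G`. -/
def LargestEigTail {d : ℕ} (hd : 0 < d) (G : Measure (Matrix (Fin d) (Fin d) ℝ)) : Prop :=
  ∃ a b C : ℝ, 0 < a ∧ 0 < b ∧ 0 < C ∧ ∀ᶠ x : ℝ in atTop,
    G {S | x ≤ eig S⁻¹ ⟨d - 1, Nat.sub_one_lt_of_lt hd⟩} ≤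
      ENNReal.ofReal (b * Real.exp (-C * x ^ a))

/-- Polynomial bound near `0` for the smallest eigenvalue of `Σ⁻¹` under `G`. -/
def SmallestEigTail {d : ℕ} (hd : 0 < d) (G : Measure (Matrix (Fin d) (Fin d) ℝ)) : Prop :=
  ∃ a b : ℝ, 0 < a ∧ 0 < b ∧ ∀ᶠ x : ℝ in 𝓝[>] 0,
    G {S | eig S⁻¹ ⟨0, hd⟩ < x} ≤ ENNReal.ofReal (b * x ^ a)

/-- Lower bound, with exponent `κ`, for the probability under `G` that the eigenvalues of `Σ⁻¹`
lie in small relative neighbourhoods to the right of prescribed values. -/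
def EigSmallBall {d : ℕ} (hd : 0 < d) (κ : ℝ) (G : Measure (Matrix (Fin d) (Fin d) ℝ)) : Prop :=
  ∃ a a' b C : ℝ, 0 < a ∧ 0 < a' ∧ 0 < b ∧ 0 < C ∧
    ∀ s : Fin d → ℝ, (∀ j, 0 < s j) → Monotone s → ∀ t : ℝ, 0 < t → t < 1 →
      ENNReal.ofReal (b * s ⟨0, hd⟩ ^ a * t ^ a' *
          Real.exp (-C * s ⟨d - 1, Nat.sub_one_lt_of_lt hd⟩ ^ (κ / 2))) ≤
        G {S | ∀ j, s j < eig S⁻¹ j ∧ eig S⁻¹ j < s j * (1 + t)}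

end

noncomputable section

/-! All three bounds concern `W = Σ⁻¹`, which is Wishart with density `K * det W ^ α * exp (-tr (Ψ
W) / 2)`, where `α = (ν - d - 1) / 2 > -1`. Only the positivity of `K` matters. The joint density of
the eigenvalues is never needed.

For the two tails, `tr (Ψ W) ≥ c * tr W` reduces everything to finiteness of `∫ det W ^ α * exp (-c
* tr W)` for all `α > -1` and `c > 0` (`lintegral_detTraceKernel_lt_top`). This goes by induction on
`d`, splitting `det W` into the determinant of a block and its Schur complement. If the largest
eigenvalue is at least `x`, so is the trace, and half of the exponential pays for `exp (-C x)`. If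
the smallest is below `x`, then `det W ≤ x * (tr W) ^ (d - 1)`; trading a small power `det W ^ a`
for `x ^ a` leaves the exponent `α - a`, still above `-1`.

For the lower bound, a box of symmetric matrices around `diag (s_j (1 + t / 2))` suffices. With
half-width of order `s_1 t`, Weyl's inequality (`abs_eig_sub_le`) keeps the eigenvalues in the
prescribed intervals. The volume of the box gives powers of `s_1` and `t`; the density there is
bounded below by a power of `s_1` times an exponential in `s_d`. -/

/-! ### Measurability, Schur complements and bordered coordinates -/

theorem measurableSet_posDef {d : ℕ} :
    MeasurableSet {W : Matrix (Fin d) (Fin d) ℝ | W.PosDef} := by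
  have hset : {W : Matrix (Fin d) (Fin d) ℝ | W.PosDef} =
      ({W | W.IsHermitian} ∩ ⋂ x : Fin d → ℝ, {W | 0 ≤ star x ⬝ᵥ W.mulVec x}) ∩
        {W | W.det ≠ 0} := by
    ext W
    simp only [Set.mem_inter_iff, Set.mem_ofPred_eq, Set.mem_iInter]
    rw [← Matrix.posSemidef_iff_dotProduct_mulVec]
    constructor
    · exact fun h => ⟨h.posSemidef, h.det_pos.ne'⟩
    · rintro ⟨h, h'⟩
      exact h.posDef_iff_isUnit.2 ((Matrix.isUnit_iff_isUnit_det W).2 h'.isUnit)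
  rw [hset]
  refine (IsClosed.inter ?_ (isClosed_iInter fun x => ?_)).measurableSet.inter ?_
  · exact isClosed_eq (Continuous.matrix_conjTranspose continuous_id) continuous_id
  · exact isClosed_le continuous_const
      (continuous_const.dotProduct (continuous_id.matrix_mulVec continuous_const))
  · exact (isOpen_ne_fun (continuous_id.matrix_det) continuous_const).measurableSet

theorem measurable_det {d : ℕ} : Measurable fun W : Matrix (Fin d) (Fin d) ℝ => W.det :=
  (continuous_id.matrix_det).measurable

theorem measurable_trace {d : ℕ} : Measurable fun W : Matrix (Fin d) (Fin d) ℝ => W.trace :=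
  (continuous_id.matrix_trace).measurable

/-- Schur complement of the lower right block of a symmetric matrix. -/
theorem det_eq_det_submatrix_succ_mul {n : ℕ} (W : Matrix (Fin (n + 1)) (Fin (n + 1)) ℝ)
    (hW : W.IsHermitian) (hM : IsUnit (W.submatrix Fin.succ Fin.succ)) :
    W.det = (W.submatrix Fin.succ Fin.succ).det *
      (W 0 0 - (fun i : Fin n => W 0 i.succ) ⬝ᵥ
        ((W.submatrix Fin.succ Fin.succ)⁻¹.mulVec fun i : Fin n => W 0 i.succ)) := by
  set M := W.submatrix Fin.succ Fin.succ
  let e : Fin (n + 1) ≃ Fin n ⊕ Unit := (finSuccEquiv n).trans (Equiv.optionEquivSumPUnit _)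
  have h0 : e.symm (Sum.inr ()) = 0 := by simp [e]
  have h1 : ∀ i, e.symm (Sum.inl i) = i.succ := by simp [e]
  have := hM.invertible
  have hdet : W.det = (W.submatrix e.symm e.symm).det := by simp
  have hb : W.submatrix e.symm e.symm = Matrix.fromBlocks M
      (Matrix.of fun i _ => W 0 i.succ) (Matrix.of fun _ j => W 0 j.succ)
      (Matrix.of fun _ _ => W 0 0) := by
    ext i j
    rcases i with i | i <;> rcases j with j | j
    · simp [h1, M]
    · simpa [h0, h1] using (hW.apply 0 i.succ)
    · simp [h0, h1]
    · simp [h0]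
  rw [hdet, hb, Matrix.det_fromBlocks₁₁]
  congr 1
  rw [Matrix.det_unique, Matrix.mul_assoc]
  simp only [Matrix.sub_apply, Matrix.of_apply, Matrix.invOf_eq_nonsing_inv]
  rfl

theorem isHermitian_symOfUpper {d : ℕ} (u : {p : Fin d × Fin d // p.1 ≤ p.2} → ℝ) :
    (symOfUpper u).IsHermitian := by
  ext i j
  simp [symOfUpper, min_comm, max_comm]

/-- The principal `2 × 2` minor on the indices `0` and `i.succ` is positive, and a diagonal entry of
the block is at most its trace. This turns decay in the corner entry into Gaussian decay in the
first row. -/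
theorem Matrix.PosDef.sq_le_mul_trace {n : ℕ} {W : Matrix (Fin (n + 1)) (Fin (n + 1)) ℝ}
    (hW : W.PosDef) (i : Fin n) :
    W 0 i.succ ^ 2 ≤ W 0 0 * (W.submatrix Fin.succ Fin.succ).trace := by
  have hinj : Function.Injective ![(0 : Fin (n + 1)), i.succ] := by
    intro a b h
    fin_cases a <;> fin_cases b <;> simp_all [Fin.succ_ne_zero, (Fin.succ_ne_zero _).symm]
  have h2 := (hW.submatrix hinj).det_pos
  rw [Matrix.det_fin_two] at h2
  have hs : W i.succ 0 = W 0 i.succ := by simpa using hW.1.apply 0 i.succ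
  simp [hs] at h2
  have h3 : W i.succ i.succ ≤ (W.submatrix Fin.succ Fin.succ).trace :=
    Finset.single_le_sum (f := fun j : Fin n => W j.succ j.succ)
      (fun j _ => (hW.diag_pos).le) (Finset.mem_univ i)
  have h4 : 0 < W 0 0 := hW.diag_pos
  nlinarith [mul_le_mul_of_nonneg_left h3 h4.le]

/-- The upper triangular positions of an `(n + 1) × (n + 1)` matrix: those of the lower right
block, the first row, and the corner. -/
def upperSuccEquiv (n : ℕ) :
    ({p : Fin n × Fin n // p.1 ≤ p.2} ⊕ Fin n) ⊕ Unit ≃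
      {p : Fin (n + 1) × Fin (n + 1) // p.1 ≤ p.2} :=
  Equiv.ofBijective
    (Sum.elim
      (Sum.elim (fun p => ⟨(p.1.1.succ, p.1.2.succ), Fin.succ_le_succ_iff.2 p.2⟩)
        fun i => ⟨(0, i.succ), Fin.zero_le _⟩)
      fun _ => ⟨(0, 0), le_rfl⟩) (by
    constructor
    · rintro ((⟨⟨a, b⟩, h⟩ | a) | a) ((⟨⟨a', b'⟩, h'⟩ | a') | a') hh <;>
        simp only [Sum.elim_inl, Sum.elim_inr, Subtype.mk.injEq, Prod.mk.injEq, Fin.succ_inj] at hh <;>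
        first
        | exact absurd hh.1 (Fin.succ_ne_zero _)
        | exact absurd hh.1.symm (Fin.succ_ne_zero _)
        | exact absurd hh.2 (Fin.succ_ne_zero _)
        | exact absurd hh.2.symm (Fin.succ_ne_zero _)
        | simp [hh]
    · rintro ⟨⟨a, b⟩, h⟩
      rcases Fin.eq_zero_or_eq_succ a with rfl | ⟨a, rfl⟩ <;>
        rcases Fin.eq_zero_or_eq_succ b with rfl | ⟨b, rfl⟩
      · exact ⟨Sum.inr (), rfl⟩
      · exact ⟨Sum.inl (Sum.inr b), rfl⟩
      · simp at h
      · exact ⟨Sum.inl (Sum.inl ⟨(a, b), Fin.succ_le_succ_iff.1 h⟩), rfl⟩)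

/-- The symmetric matrix with corner `a`, first row `v` and lower right block `symOfUpper w`. -/
def bordered {n : ℕ} (w : {p : Fin n × Fin n // p.1 ≤ p.2} → ℝ) (v : Fin n → ℝ) (a : ℝ) :
    Matrix (Fin (n + 1)) (Fin (n + 1)) ℝ :=
  symOfUpper fun p => Sum.elim (Sum.elim w v) (fun _ => a) ((upperSuccEquiv n).symm p)

theorem bordered_zero_zero {n : ℕ} (w : {p : Fin n × Fin n // p.1 ≤ p.2} → ℝ) (v : Fin n → ℝ)
    (a : ℝ) : bordered w v a 0 0 = a := by
  have : (upperSuccEquiv n).symm ⟨(0, 0), le_rfl⟩ = Sum.inr () := by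
    rw [Equiv.symm_apply_eq]; rfl
  simp [bordered, symOfUpper, this]

theorem bordered_zero_succ {n : ℕ} (w : {p : Fin n × Fin n // p.1 ≤ p.2} → ℝ) (v : Fin n → ℝ)
    (a : ℝ) (i : Fin n) : bordered w v a 0 i.succ = v i := by
  have : (upperSuccEquiv n).symm ⟨(0, i.succ), Fin.zero_le _⟩ = Sum.inl (Sum.inr i) := by
    rw [Equiv.symm_apply_eq]; rfl
  simp [bordered, symOfUpper, this]

theorem bordered_submatrix {n : ℕ} (w : {p : Fin n × Fin n // p.1 ≤ p.2} → ℝ) (v : Fin n → ℝ)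
    (a : ℝ) : (bordered w v a).submatrix Fin.succ Fin.succ = symOfUpper w := by
  ext i j
  have : (upperSuccEquiv n).symm ⟨((min i j).succ, (max i j).succ),
      Fin.succ_le_succ_iff.2 min_le_max⟩ = Sum.inl (Sum.inl ⟨(min i j, max i j), min_le_max⟩) := by
    rw [Equiv.symm_apply_eq]; rfl
  have h1 : min i.succ j.succ = (min i j).succ := (Fin.strictMono_succ.monotone.map_min).symm
  have h2 : max i.succ j.succ = (max i j).succ := (Fin.strictMono_succ.monotone.map_max).symm
  simp [bordered, symOfUpper, h1, h2, this]

theorem isHermitian_bordered {n : ℕ} (w : {p : Fin n × Fin n // p.1 ≤ p.2} → ℝ) (v : Fin n → ℝ)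
    (a : ℝ) : (bordered w v a).IsHermitian := isHermitian_symOfUpper _

theorem measurePreserving_upperSucc (n : ℕ) :
    MeasurePreserving
      (fun x : (({p : Fin n × Fin n // p.1 ≤ p.2} → ℝ) × (Fin n → ℝ)) × ℝ =>
        fun p => Sum.elim (Sum.elim x.1.1 x.1.2) (fun _ => x.2) ((upperSuccEquiv n).symm p))
      volume volume := by
  have h1 := volume_measurePreserving_sumPiEquivProdPi_symm
    (fun _ : {p : Fin n × Fin n // p.1 ≤ p.2} ⊕ Fin n => ℝ)
  have h2 := volume_measurePreserving_sumPiEquivProdPi_symm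
    (fun _ : ({p : Fin n × Fin n // p.1 ≤ p.2} ⊕ Fin n) ⊕ Unit => ℝ)
  have h3 := volume_measurePreserving_piCongrLeft (fun _ => ℝ) (upperSuccEquiv n)
  have h4 := (volume_preserving_funUnique Unit ℝ).symm
  have h := (h3.comp h2).comp (h1.prod h4)
  have heq : (fun x : (({p : Fin n × Fin n // p.1 ≤ p.2} → ℝ) × (Fin n → ℝ)) × ℝ =>
      fun p => Sum.elim (Sum.elim x.1.1 x.1.2) (fun _ => x.2) ((upperSuccEquiv n).symm p)) =
      (MeasurableEquiv.piCongrLeft (fun _ => ℝ) (upperSuccEquiv n) ∘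
        (MeasurableEquiv.sumPiEquivProdPi fun _ => ℝ).symm) ∘
          Prod.map (MeasurableEquiv.sumPiEquivProdPi fun _ => ℝ).symm
            (MeasurableEquiv.funUnique Unit ℝ).symm := by
    funext x p
    obtain ⟨q, rfl⟩ := (upperSuccEquiv n).surjective p
    simp only [Function.comp, MeasurableEquiv.piCongrLeft, Prod.map]
    erw [Equiv.piCongrLeft_apply_apply]
    rw [Equiv.symm_apply_apply]
    rcases q with (q | q) | q <;> rfl
  rw [heq]
  exact h

theorem measurable_bordered {n : ℕ} :
    Measurable fun x : (({p : Fin n × Fin n // p.1 ≤ p.2} → ℝ) × (Fin n → ℝ)) × ℝ =>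
      bordered x.1.1 x.1.2 x.2 :=
  measurable_symOfUpper.comp (measurePreserving_upperSucc n).measurable

theorem lintegral_symLebesgue_succ {n : ℕ}
    {F : Matrix (Fin (n + 1)) (Fin (n + 1)) ℝ → ENNReal} (hF : Measurable F) :
    ∫⁻ W, F W ∂symLebesgue (n + 1) =
      ∫⁻ w : {p : Fin n × Fin n // p.1 ≤ p.2} → ℝ, ∫⁻ v : Fin n → ℝ, ∫⁻ a : ℝ,
        F (bordered w v a) := by
  rw [symLebesgue, lintegral_map hF measurable_symOfUpper]
  refine ((measurePreserving_upperSucc n).lintegral_comp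
    (hF.comp measurable_symOfUpper)).symm.trans ?_
  have hm := hF.comp (measurable_bordered (n := n))
  exact (lintegral_prod _ hm.aemeasurable).trans
    (lintegral_prod _ hm.lintegral_prod_right'.aemeasurable)

/-! ### Finiteness of the determinant-trace integral -/

theorem exists_one_add_mul_pow_le_exp (n : ℕ) {k δ : ℝ} (hk : 0 ≤ k) (hδ : 0 < δ) :
    ∃ C : ℝ, 0 < C ∧ ∀ T : ℝ, 0 ≤ T → (1 + k * T) ^ n ≤ C * Real.exp (δ * T) := by
  refine ⟨(1 + k * (n + 1) / δ) ^ n, by positivity, fun T hT => ?_⟩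
  -- The `n`-th power of this is the claim; `n + 1` in place of `n` avoids dividing by zero when `n
  -- = 0`.
  have h1 : 1 + k * T ≤ (1 + k * (n + 1) / δ) * Real.exp (δ * T / (n + 1)) := by
    have h2 : δ * T / (n + 1) + 1 ≤ Real.exp (δ * T / (n + 1)) := Real.add_one_le_exp _
    have h3 : k * (n + 1) / δ * (δ * T / (n + 1)) = k * T := by field_simp
    have h4 : 0 ≤ k * (n + 1) / δ := by positivity
    have h5 : 0 ≤ δ * T / (n + 1) := by positivity
    nlinarith [mul_le_mul_of_nonneg_left h2 (by positivity : 0 ≤ 1 + k * (n + 1) / δ)]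
  calc (1 + k * T) ^ n ≤ ((1 + k * (n + 1) / δ) * Real.exp (δ * T / (n + 1))) ^ n :=
        pow_le_pow_left₀ (by positivity) h1 n
    _ = (1 + k * (n + 1) / δ) ^ n * Real.exp (n * (δ * T / (n + 1))) := by
        rw [mul_pow, ← Real.exp_nat_mul]
    _ ≤ _ := by
        refine mul_le_mul_of_nonneg_left (Real.exp_le_exp.2 ?_) (by positivity)
        rw [mul_div_assoc', div_le_iff₀ (by positivity)]
        nlinarith [mul_nonneg hδ.le hT]

theorem lintegral_gaussian_pi {n : ℕ} {b : ℝ} (hb : 0 < b) :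
    ∫⁻ v : Fin n → ℝ, ENNReal.ofReal (Real.exp (-b * ∑ i, v i ^ 2)) =
      ENNReal.ofReal (√(Real.pi / b) ^ n) := by
  have h : ∀ v : Fin n → ℝ, Real.exp (-b * ∑ i, v i ^ 2) = ∏ i, Real.exp (-b * v i ^ 2) := by
    intro v
    rw [← Real.exp_sum, Finset.mul_sum]
  simp_rw [h]
  rw [volume_pi, ← ofReal_integral_eq_lintegral_ofReal
    (Integrable.fintype_prod fun _ => integrable_exp_neg_mul_sq hb)
    (Eventually.of_forall fun v => by positivity), ← volume_pi,
    integral_fintype_prod_volume_eq_prod (fun (_ : Fin n) (x : ℝ) => Real.exp (-b * x ^ 2))]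
  simp [← integral_gaussian]

open Classical in
/-- The unnormalised Wishart-type kernel `det W ^ α * exp (-c * tr W)` on positive definite
matrices. -/
def detTraceKernel {d : ℕ} (α c : ℝ) (W : Matrix (Fin d) (Fin d) ℝ) : ENNReal :=
  if W.PosDef then ENNReal.ofReal (W.det ^ α * Real.exp (-c * W.trace)) else 0

theorem measurable_detTraceKernel {d : ℕ} (α c : ℝ) :
    Measurable (detTraceKernel (d := d) α c) := by
  classical
  refine Measurable.ite measurableSet_posDef ?_ measurable_const
  exact ENNReal.measurable_ofReal.comp
    ((measurable_det.pow_const α).mul (measurable_trace.const_mul (-c)).exp)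

/-- Contribution of the corner entry in the Schur complement recursion. -/
def cornerIntegral (α c : ℝ) : ENNReal :=
  ∫⁻ a in Set.Ioi (0 : ℝ), ENNReal.ofReal (a ^ α * Real.exp (-c * a))

theorem cornerIntegral_lt_top {α c : ℝ} (hα : -1 < α) (hc : 0 < c) : cornerIntegral α c < ⊤ := by
  have h := integrableOn_rpow_mul_exp_neg_mul_rpow (p := 1) hα one_pos hc
  simp only [Real.rpow_one] at h
  exact h.lintegral_lt_top

/-- The determinant factors exactly through the Schur complement `a - q`. The factor `exp (-c * a)`
is cut in two halves: one dominates the Gaussian in `v`, because `v i ^ 2 ≤ a * tr M`, and the other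
is at most `exp (-(c / 2) * (a - q))`, because `q ≥ 0`. -/
theorem detTraceKernel_bordered_le {n : ℕ} {α c : ℝ} (hc : 0 < c)
    (w : {p : Fin n × Fin n // p.1 ≤ p.2} → ℝ) (v : Fin n → ℝ) (a : ℝ) :
    detTraceKernel α c (bordered w v a) ≤
      detTraceKernel α c (symOfUpper w) *
        (ENNReal.ofReal (Real.exp (-(c / (2 * (n + 1) * (symOfUpper w).trace)) * ∑ i, v i ^ 2)) *
        (Set.Ioi (0 : ℝ)).indicator (fun x => ENNReal.ofReal (x ^ α * Real.exp (-(c / 2) * x)))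
          (a - v ⬝ᵥ ((symOfUpper w)⁻¹.mulVec v))) := by
  by_cases hW : (bordered w v a).PosDef
  swap
  · simp [detTraceKernel, hW]
  have hM : (symOfUpper w).PosDef := by
    rw [← bordered_submatrix w v a]; exact hW.submatrix (Fin.succ_injective n)
  have hdet := det_eq_det_submatrix_succ_mul _ (isHermitian_bordered w v a)
    (by rw [bordered_submatrix]; exact hM.isUnit)
  simp only [bordered_submatrix, bordered_zero_zero, bordered_zero_succ] at hdet
  have hq : 0 ≤ v ⬝ᵥ ((symOfUpper w)⁻¹.mulVec v) := by
    simpa using hM.inv.posSemidef.dotProduct_mulVec_nonneg v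
  set q := v ⬝ᵥ ((symOfUpper w)⁻¹.mulVec v)
  set M := symOfUpper w
  have hx : 0 < a - q := by
    have := hW.det_pos
    rw [hdet] at this
    exact (mul_pos_iff_of_pos_left hM.det_pos).1 this
  have ha : 0 < a := by linarith
  have htr : (bordered w v a).trace = a + M.trace := by
    have : M.trace = ∑ i : Fin n, bordered w v a i.succ i.succ := by
      simp only [M]; rw [← bordered_submatrix w v a]; rfl
    rw [this, Matrix.trace, Fin.sum_univ_succ]
    simp [bordered_zero_zero]
  have hsum : c / (2 * (n + 1) * M.trace) * ∑ i, v i ^ 2 ≤ c / 2 * a := by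
    have h1 : ∀ i, v i ^ 2 ≤ a * M.trace := by
      intro i
      have := hW.sq_le_mul_trace i
      simpa only [bordered_submatrix, bordered_zero_zero, bordered_zero_succ] using this
    have hT : 0 ≤ M.trace := hM.posSemidef.trace_nonneg
    have h2 : ∑ i, v i ^ 2 ≤ n * (a * M.trace) := by
      calc ∑ i, v i ^ 2 ≤ ∑ _i : Fin n, a * M.trace := Finset.sum_le_sum fun i _ => h1 i
        _ = _ := by simp
    rcases hT.eq_or_lt with hT | hT
    · rw [← hT]; simp; positivity
    · rw [div_mul_eq_mul_div, div_le_iff₀ (by positivity)]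
      have h3 : ∑ i, v i ^ 2 ≤ (n + 1) * (a * M.trace) := by nlinarith [mul_pos ha hT]
      nlinarith [mul_le_mul_of_nonneg_left h3 hc.le]
  rw [Set.indicator_of_mem (Set.mem_Ioi.2 hx)]
  simp only [detTraceKernel, if_pos hW, if_pos hM]
  rw [← ENNReal.ofReal_mul (by positivity), ← ENNReal.ofReal_mul (by have := hM.det_pos; positivity)]
  apply ENNReal.ofReal_le_ofReal
  rw [hdet, htr, Real.mul_rpow hM.det_pos.le hx.le]
  have hexp : Real.exp (-c * (a + M.trace)) ≤ Real.exp (-c * M.trace) *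
      (Real.exp (-(c / (2 * (n + 1) * M.trace)) * ∑ i, v i ^ 2) *
        Real.exp (-(c / 2) * (a - q))) := by
    rw [← Real.exp_add, ← Real.exp_add]
    apply Real.exp_le_exp.2
    nlinarith [mul_nonneg hc.le hq]
  have hp : 0 ≤ M.det ^ α * (a - q) ^ α :=
    mul_nonneg (Real.rpow_nonneg hM.det_pos.le _) (Real.rpow_nonneg hx.le _)
  calc _ ≤ M.det ^ α * (a - q) ^ α * (Real.exp (-c * M.trace) *
      (Real.exp (-(c / (2 * (n + 1) * M.trace)) * ∑ i, v i ^ 2) *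
        Real.exp (-(c / 2) * (a - q)))) := mul_le_mul_of_nonneg_left hexp hp
    _ = _ := by ring

/-- Translation invariance: the shift `q` depends on the block and the row, but not on the corner.
-/
theorem lintegral_corner {α c : ℝ} (q : ℝ) :
    ∫⁻ a : ℝ, (Set.Ioi (0 : ℝ)).indicator
      (fun x => ENNReal.ofReal (x ^ α * Real.exp (-c * x))) (a - q) = cornerIntegral α c := by
  rw [lintegral_sub_right_eq_self (fun a => (Set.Ioi (0 : ℝ)).indicator
      (fun x => ENNReal.ofReal (x ^ α * Real.exp (-c * x))) a) q,
    lintegral_indicator measurableSet_Ioi, cornerIntegral]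

/-- The Gaussian integral over the first row grows only polynomially in the trace of the block, so
half of the remaining exponential absorbs it. Each step thus keeps `α` and halves `c`, which is why
`c` is quantified inside the induction. -/
theorem lintegral_detTraceKernel_lt_top (d : ℕ) {α : ℝ} (hα : -1 < α) :
    ∀ c : ℝ, 0 < c → ∫⁻ W, detTraceKernel α c W ∂symLebesgue d < ⊤ := by
  induction d with
  | zero =>
    intro c hc
    rw [symLebesgue, lintegral_map (measurable_detTraceKernel _ _) measurable_symOfUpper]
    have : ∀ u : {p : Fin 0 × Fin 0 // p.1 ≤ p.2} → ℝ,
        detTraceKernel α c (symOfUpper u) ≤ 1 := by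
      intro u
      unfold detTraceKernel
      split_ifs <;> simp [Matrix.trace]
    refine (lintegral_mono this).trans_lt ?_
    have : IsEmpty {p : Fin 0 × Fin 0 // p.1 ≤ p.2} := ⟨fun p => p.1.1.elim0⟩
    simp [volume_pi]
  | succ n ih =>
    intro c hc
    rw [lintegral_symLebesgue_succ (measurable_detTraceKernel _ _)]
    -- With this `k`, each Gaussian coordinate integrates to `√(k * T) ≤ 1 + k * T`.
    obtain ⟨C, hC0, hC⟩ := exists_one_add_mul_pow_le_exp n
      (k := Real.pi * (2 * (n + 1)) / c) (δ := c / 2) (by positivity) (by positivity)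
    have key : ∀ w : {p : Fin n × Fin n // p.1 ≤ p.2} → ℝ,
        (∫⁻ v : Fin n → ℝ, ∫⁻ a : ℝ, detTraceKernel α c (bordered w v a)) ≤
          detTraceKernel α (c / 2) (symOfUpper w) *
            (ENNReal.ofReal C * cornerIntegral α (c / 2)) := by
      intro w
      have h1 : ∀ v : Fin n → ℝ, (∫⁻ a : ℝ, detTraceKernel α c (bordered w v a)) ≤
          detTraceKernel α c (symOfUpper w) * cornerIntegral α (c / 2) *
            ENNReal.ofReal
              (Real.exp (-(c / (2 * (n + 1) * (symOfUpper w).trace)) * ∑ i, v i ^ 2)) := by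
        intro v
        refine (lintegral_mono fun a => detTraceKernel_bordered_le hc w v a).trans ?_
        rw [lintegral_const_mul' _ _ (by unfold detTraceKernel; split_ifs <;> simp),
          lintegral_const_mul' _ _ ENNReal.ofReal_ne_top, lintegral_corner]
        apply le_of_eq; ring
      refine (lintegral_mono h1).trans ?_
      rw [lintegral_const_mul' _ _ (ENNReal.mul_ne_top
        (by unfold detTraceKernel; split_ifs <;> simp)
        (cornerIntegral_lt_top hα (by positivity)).ne)]
      by_cases hM : (symOfUpper w).PosDef
      swap
      · simp [detTraceKernel, hM]
      set T := (symOfUpper w).trace with hTdef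
      have hT : 0 ≤ T := hM.posSemidef.trace_nonneg
      have hgauss : ∫⁻ v : Fin n → ℝ, ENNReal.ofReal
          (Real.exp (-(c / (2 * (n + 1) * T)) * ∑ i, v i ^ 2)) ≤
          ENNReal.ofReal (C * Real.exp (c / 2 * T)) := by
        rcases Nat.eq_zero_or_pos n with rfl | hn
        · have := hC T hT
          simp only [pow_zero] at this
          simpa [volume_pi, Measure.pi_of_empty] using this
        have hne : Nonempty (Fin n) := ⟨⟨0, hn⟩⟩
        have hT' : 0 < T := hM.trace_pos
        rw [lintegral_gaussian_pi (by positivity)]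
        apply ENNReal.ofReal_le_ofReal
        refine le_trans (pow_le_pow_left₀ (Real.sqrt_nonneg _) ?_ n) (hC T hT)
        have : Real.pi / (c / (2 * (n + 1) * T)) = Real.pi * (2 * (n + 1)) / c * T := by
          field_simp
        rw [this, Real.sqrt_le_left (by positivity)]
        have : 0 ≤ Real.pi * (2 * (n + 1)) / c * T := by positivity
        nlinarith
      calc _ ≤ detTraceKernel α c (symOfUpper w) * cornerIntegral α (c / 2) *
            ENNReal.ofReal (C * Real.exp (c / 2 * T)) := by gcongr
        _ = (detTraceKernel α c (symOfUpper w) * ENNReal.ofReal (Real.exp (c / 2 * T))) *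
            (ENNReal.ofReal C * cornerIntegral α (c / 2)) := by
          rw [ENNReal.ofReal_mul hC0.le]; ring
        _ = _ := by
          congr 1
          have := hM.det_pos
          simp only [detTraceKernel, if_pos hM]
          rw [← ENNReal.ofReal_mul (by positivity), mul_assoc, ← Real.exp_add, ← hTdef]
          congr 3
          ring
    refine (lintegral_mono key).trans_lt ?_
    rw [lintegral_mul_const' _ _ (ENNReal.mul_ne_top ENNReal.ofReal_ne_top
      (cornerIntegral_lt_top hα (by positivity)).ne)]
    refine ENNReal.mul_lt_top ?_ (ENNReal.mul_lt_top ENNReal.ofReal_lt_top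
      (cornerIntegral_lt_top hα (by positivity)))
    have := ih (c / 2) (by positivity)
    rwa [symLebesgue, lintegral_map (measurable_detTraceKernel _ _) measurable_symOfUpper] at this

/-! ### Eigenvalues, trace and determinant -/

theorem exists_equiv_eig_eq_eigenvalues {d : ℕ} {A : Matrix (Fin d) (Fin d) ℝ}
    (hA : A.IsHermitian) : ∃ σ : Fin d ≃ Fin d, ∀ j, eig A j = hA.eigenvalues (σ j) := by
  refine ⟨(Fin.revPerm.trans (finCongr (Fintype.card_fin d).symm)).trans
    (Fintype.equivOfCardEq (Fintype.card_fin _)), fun j => ?_⟩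
  rw [eig, dif_pos hA]
  simp [Matrix.IsHermitian.eigenvalues]

theorem monotone_eig {d : ℕ} (A : Matrix (Fin d) (Fin d) ℝ) : Monotone (eig A) := by
  intro i j hij
  unfold eig
  split_ifs with h
  · exact h.eigenvalues₀_antitone (by simpa [Fin.le_def] using Fin.rev_le_rev.2 hij)
  · exact le_rfl

theorem trace_eq_sum_eig {d : ℕ} {A : Matrix (Fin d) (Fin d) ℝ} (hA : A.IsHermitian) :
    A.trace = ∑ j, eig A j := by
  obtain ⟨σ, hσ⟩ := exists_equiv_eig_eq_eigenvalues hA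
  rw [hA.trace_eq_sum_eigenvalues, ← Equiv.sum_comp σ]
  simp [hσ]

theorem det_eq_prod_eig {d : ℕ} {A : Matrix (Fin d) (Fin d) ℝ} (hA : A.IsHermitian) :
    A.det = ∏ j, eig A j := by
  obtain ⟨σ, hσ⟩ := exists_equiv_eig_eq_eigenvalues hA
  rw [hA.det_eq_prod_eigenvalues, ← Equiv.prod_comp σ]
  simp [hσ]

theorem posDef_iff_eig_pos {d : ℕ} {A : Matrix (Fin d) (Fin d) ℝ} (hA : A.IsHermitian) :
    A.PosDef ↔ ∀ j, 0 < eig A j := by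
  obtain ⟨σ, hσ⟩ := exists_equiv_eig_eq_eigenvalues hA
  rw [hA.posDef_iff_eigenvalues_pos, ← σ.forall_congr_right]
  simp [hσ]

theorem Matrix.PosDef.eig_le_trace {d : ℕ} {A : Matrix (Fin d) (Fin d) ℝ} (hA : A.PosDef)
    (j : Fin d) : eig A j ≤ A.trace := by
  rw [trace_eq_sum_eig hA.1]
  exact Finset.single_le_sum (fun i _ => ((posDef_iff_eig_pos hA.1).1 hA i).le)
    (Finset.mem_univ j)

theorem Matrix.PosDef.det_le_eig_mul {d : ℕ} {A : Matrix (Fin d) (Fin d) ℝ} (hA : A.PosDef)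
    (j : Fin d) : A.det ≤ eig A j * A.trace ^ (d - 1) := by
  have hpos := (posDef_iff_eig_pos hA.1).1 hA
  rw [det_eq_prod_eig hA.1, ← Finset.mul_prod_erase _ _ (Finset.mem_univ j)]
  refine mul_le_mul_of_nonneg_left ?_ (hpos j).le
  calc ∏ i ∈ Finset.univ.erase j, eig A i ≤ ∏ _i ∈ Finset.univ.erase j, A.trace :=
        Finset.prod_le_prod (fun i _ => (hpos i).le) fun i _ => hA.eig_le_trace i
    _ = _ := by simp

/-- In an eigenbasis of `P`, `tr (P W)` is the sum of the nonnegative diagonal entries of the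
rotated `W`, weighted by the eigenvalues of `P`; the smallest of these serves as `c`. -/
theorem Matrix.PosDef.exists_mul_trace_le {d : ℕ} {P : Matrix (Fin d) (Fin d) ℝ}
    (hP : P.PosDef) : ∃ c : ℝ, 0 < c ∧
      ∀ W : Matrix (Fin d) (Fin d) ℝ, W.PosSemidef → c * W.trace ≤ (P * W).trace := by
  obtain ⟨c, hc, hle⟩ : ∃ c : ℝ, 0 < c ∧ ∀ i, c ≤ hP.1.eigenvalues i := by
    rcases isEmpty_or_nonempty (Fin d) with h | h
    · exact ⟨1, one_pos, fun i => isEmptyElim i⟩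
    · obtain ⟨i, hi⟩ := Finite.exists_min hP.1.eigenvalues
      exact ⟨_, hP.eigenvalues_pos i, hi⟩
  refine ⟨c, hc, fun W hW => ?_⟩
  obtain ⟨U, hU⟩ : ∃ U : Matrix (Fin d) (Fin d) ℝ, U = hP.1.eigenvectorUnitary := ⟨_, rfl⟩
  have hUU : U * star U = 1 := hU ▸ Unitary.coe_mul_star_self _
  have hV := hW.conjTranspose_mul_mul_same U
  have h1 : (P * W).trace = ∑ i, hP.1.eigenvalues i * (star U * W * U) i i := by
    conv_lhs => rw [hP.1.spectral_theorem]
    rw [Unitary.conjStarAlgAut_apply, ← hU, Matrix.mul_assoc, Matrix.mul_assoc,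
      Matrix.trace_mul_comm, Matrix.mul_assoc, Matrix.trace]
    simp [Matrix.diagonal_mul]
  have h2 : W.trace = ∑ i, (star U * W * U) i i := by
    change _ = (star U * W * U).trace
    rw [Matrix.trace_mul_comm, ← Matrix.mul_assoc, hUU, Matrix.one_mul]
  rw [h1, h2, Finset.mul_sum]
  exact Finset.sum_le_sum fun i _ => mul_le_mul_of_nonneg_right (hle i) hV.diag_nonneg

/-! ### The Wishart density and the two tail bounds -/

theorem multiGamma_pos {d : ℕ} {a : ℝ} (ha : (d : ℝ) - 1 < 2 * a) : 0 < multiGamma d a := by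
  refine mul_pos (Real.rpow_pos_of_pos Real.pi_pos _) (Finset.prod_pos fun j _ => ?_)
  apply Real.Gamma_pos_of_pos
  have : ((j : ℕ) : ℝ) + 1 ≤ d := by exact_mod_cast j.2
  linarith

theorem wishart_posDef_compl {d : ℕ} (ν : ℝ) (V : Matrix (Fin d) (Fin d) ℝ) :
    wishart ν V {W | ¬ W.PosDef} = 0 := by
  have hm : MeasurableSet {W : Matrix (Fin d) (Fin d) ℝ | ¬ W.PosDef} :=
    measurableSet_posDef.compl
  rw [wishart, withDensity_apply _ hm, setLIntegral_congr_fun (g := fun _ => 0) hm]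
  · simp
  · intro W hW
    have hW' : ¬ W.PosDef := hW
    simp [wishartDensity, hW']

/-- The Wishart density, up to a positive constant. -/
theorem exists_wishartDensity_eq {d : ℕ} {ν : ℝ} (hν : (d : ℝ) - 1 < ν)
    {Ψ : Matrix (Fin d) (Fin d) ℝ} (hΨ : Ψ.PosDef) :
    ∃ K : ℝ, 0 < K ∧ ∀ W : Matrix (Fin d) (Fin d) ℝ, W.PosDef →
      wishartDensity ν Ψ⁻¹ W =
        K * (W.det ^ ((ν - (d : ℝ) - 1) / 2) * Real.exp (-(Ψ * W).trace / 2)) := by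
  have hZ : 0 < (2 : ℝ) ^ (ν * (d : ℝ) / 2) * Ψ⁻¹.det ^ (ν / 2) * multiGamma d (ν / 2) :=
    mul_pos (mul_pos (Real.rpow_pos_of_pos two_pos _)
      (Real.rpow_pos_of_pos hΨ.inv.det_pos _)) (multiGamma_pos (by linarith))
  refine ⟨_, inv_pos.2 hZ, fun W hW => ?_⟩
  rw [wishartDensity, if_pos hW, Matrix.nonsing_inv_nonsing_inv _ hΨ.det_pos.ne'.isUnit,
    div_eq_inv_mul]

/-- Common engine of both tails: a pointwise comparison of kernels on `A` becomes a bound on its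
probability. The freedom in `α` and `c'` allows part of the density to be spent on smallness. -/
theorem exists_invWishart_le {d : ℕ} {ν : ℝ} (hν : (d : ℝ) - 1 < ν)
    {Ψ : Matrix (Fin d) (Fin d) ℝ} (hΨ : Ψ.PosDef) :
    ∃ K c : ℝ, 0 < K ∧ 0 < c ∧ ∀ (A : Set (Matrix (Fin d) (Fin d) ℝ)) (α c' B : ℝ), 0 ≤ B →
      (∀ W : Matrix (Fin d) (Fin d) ℝ, W.PosDef → W ∈ A →
        W.det ^ ((ν - (d : ℝ) - 1) / 2) * Real.exp (-c * W.trace) ≤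
          B * (W.det ^ α * Real.exp (-c' * W.trace))) →
      invWishart ν Ψ {S | S⁻¹ ∈ A} ≤
        ENNReal.ofReal (K * B) * ∫⁻ W, detTraceKernel α c' W ∂symLebesgue d := by
  obtain ⟨K, hK, hdens⟩ := exists_wishartDensity_eq hν hΨ
  obtain ⟨c, hc, htr⟩ := hΨ.exists_mul_trace_le
  refine ⟨K, c / 2, hK, by positivity, fun A α c' B hB hA => ?_⟩
  -- `A` need not be measurable, so it is enlarged to the set where the comparison holds, together
  -- with the null set of matrices that are not positive definite. The latter also absorbs every
  -- singular `W`, for which `W⁻¹⁻¹` need not be `W`.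
  set T : Set (Matrix (Fin d) (Fin d) ℝ) :=
    {W | W.det ^ ((ν - (d : ℝ) - 1) / 2) * Real.exp (-(c / 2) * W.trace) ≤
          B * (W.det ^ α * Real.exp (-c' * W.trace))}
  have hT : MeasurableSet T := measurableSet_le
    ((measurable_det.pow_const _).mul (measurable_trace.const_mul _).exp)
    (((measurable_det.pow_const _).mul (measurable_trace.const_mul _).exp).const_mul B)
  set N : Set (Matrix (Fin d) (Fin d) ℝ) := {W | ¬ W.PosDef}
  have hN : MeasurableSet N := measurableSet_posDef.compl
  have hsub : {S : Matrix (Fin d) (Fin d) ℝ | S⁻¹ ∈ A} ⊆ {S | S⁻¹ ∈ N ∪ T} := by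
    intro S hS
    by_cases h : (S⁻¹).PosDef
    · exact Or.inr (hA _ h hS)
    · exact Or.inl h
  have hsub' : {W : Matrix (Fin d) (Fin d) ℝ | W⁻¹⁻¹ ∈ N ∪ T} ⊆ N ∪ T := by
    intro W hW
    by_cases h : W.PosDef
    · rwa [Set.mem_ofPred_eq, Matrix.nonsing_inv_nonsing_inv _ h.det_pos.ne'.isUnit] at hW
    · exact Or.inl h
  calc invWishart ν Ψ {S | S⁻¹ ∈ A} ≤ invWishart ν Ψ {S | S⁻¹ ∈ N ∪ T} := measure_mono hsub
    _ = wishart ν Ψ⁻¹ {W | W⁻¹⁻¹ ∈ N ∪ T} := by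
        exact Measure.map_apply measurable_matrix_inv
          (measurable_matrix_inv (hN.union hT))
    _ ≤ wishart ν Ψ⁻¹ (N ∪ T) := measure_mono hsub'
    _ ≤ wishart ν Ψ⁻¹ N + wishart ν Ψ⁻¹ T := measure_union_le _ _
    _ = ∫⁻ W in T, ENNReal.ofReal (wishartDensity ν Ψ⁻¹ W) ∂symLebesgue d := by
        rw [wishart_posDef_compl, zero_add, wishart, withDensity_apply _ hT]
    _ ≤ ∫⁻ W in T, ENNReal.ofReal (K * B) * detTraceKernel α c' W ∂symLebesgue d := by
        refine setLIntegral_mono' hT fun W hW => ?_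
        by_cases h : W.PosDef
        swap
        · simp [wishartDensity, h]
        rw [detTraceKernel, if_pos h, ← ENNReal.ofReal_mul (by positivity), hdens W h]
        apply ENNReal.ofReal_le_ofReal
        rw [mul_assoc]
        refine mul_le_mul_of_nonneg_left (le_trans ?_ hW) hK.le
        refine mul_le_mul_of_nonneg_left (Real.exp_le_exp.2 ?_)
          (Real.rpow_nonneg h.det_pos.le _)
        linarith [htr W h.posSemidef]
    _ ≤ ∫⁻ W, ENNReal.ofReal (K * B) * detTraceKernel α c' W ∂symLebesgue d :=
        setLIntegral_le_lintegral _ _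
    _ = _ := lintegral_const_mul' _ _ ENNReal.ofReal_ne_top

theorem largestEigTail_invWishart {d : ℕ} (hd : 0 < d) {ν : ℝ} (hν : (d : ℝ) - 1 < ν)
    {Ψ : Matrix (Fin d) (Fin d) ℝ} (hΨ : Ψ.PosDef) : LargestEigTail hd (invWishart ν Ψ) := by
  obtain ⟨K, c, hK, hc, hle⟩ := exists_invWishart_le hν hΨ
  set α := (ν - (d : ℝ) - 1) / 2
  have hα : -1 < α := by simp only [α]; linarith
  have hI := lintegral_detTraceKernel_lt_top d hα (c / 2) (by positivity)
  obtain ⟨I, hI0, hI⟩ : ∃ I : ℝ, 0 ≤ I ∧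
      ∫⁻ W, detTraceKernel α (c / 2) W ∂symLebesgue d = ENNReal.ofReal I :=
    ⟨_, ENNReal.toReal_nonneg, (ENNReal.ofReal_toReal hI.ne).symm⟩
  -- The `+ 1` makes the constant positive, as only `0 ≤ I` is at hand.
  refine ⟨1, K * I + 1, c / 2, one_pos, by positivity, by positivity,
    Eventually.of_forall fun x => ?_⟩
  refine (hle {W | x ≤ eig W ⟨d - 1, Nat.sub_one_lt_of_lt hd⟩} α (c / 2)
    (Real.exp (-(c / 2) * x)) (by positivity) fun W hW hx => ?_).trans ?_
  · have hx' : x ≤ W.trace := le_trans hx (hW.eig_le_trace _)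
    have hdet := Real.rpow_nonneg hW.det_pos.le α
    rw [mul_left_comm, ← Real.exp_add]
    refine mul_le_mul_of_nonneg_left (Real.exp_le_exp.2 ?_) hdet
    nlinarith
  · rw [hI, ← ENNReal.ofReal_mul (by positivity), Real.rpow_one]
    apply ENNReal.ofReal_le_ofReal
    nlinarith [Real.exp_pos (-(c / 2) * x)]

theorem smallestEigTail_invWishart {d : ℕ} (hd : 0 < d) {ν : ℝ} (hν : (d : ℝ) - 1 < ν)
    {Ψ : Matrix (Fin d) (Fin d) ℝ} (hΨ : Ψ.PosDef) : SmallestEigTail hd (invWishart ν Ψ) := by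
  obtain ⟨K, c, hK, hc, hle⟩ := exists_invWishart_le hν hΨ
  set α := (ν - (d : ℝ) - 1) / 2
  have hα : -1 < α := by simp only [α]; linarith
  -- The second bound keeps `α - a > -1`; the first lets the power `a` of a quantity at least `1` be
  -- bounded by the quantity itself.
  set a := min 1 ((α + 1) / 2)
  have ha : 0 < a := lt_min one_pos (by linarith)
  have ha1 : a ≤ 1 := min_le_left _ _
  have haα : -1 < α - a := by
    have : a ≤ (α + 1) / 2 := min_le_right _ _
    linarith
  obtain ⟨C, hC0, hC⟩ := exists_one_add_mul_pow_le_exp (d - 1) (k := 1) (δ := c / 2)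
    zero_le_one (by positivity)
  have hI := lintegral_detTraceKernel_lt_top d haα (c / 2) (by positivity)
  obtain ⟨I, hI0, hI⟩ : ∃ I : ℝ, 0 ≤ I ∧
      ∫⁻ W, detTraceKernel (α - a) (c / 2) W ∂symLebesgue d = ENNReal.ofReal I :=
    ⟨_, ENNReal.toReal_nonneg, (ENNReal.ofReal_toReal hI.ne).symm⟩
  refine ⟨a, K * C * I + 1, ha, by positivity, ?_⟩
  filter_upwards [self_mem_nhdsWithin] with x hx
  have hx : 0 < x := hx
  have hxa : 0 < x ^ a := Real.rpow_pos_of_pos hx a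
  refine (hle {W | eig W ⟨0, hd⟩ < x} (α - a) (c / 2) (x ^ a * C) (by positivity)
    fun W hW hWx => ?_).trans ?_
  · have hdet := hW.det_pos
    have htr : 0 ≤ W.trace := hW.posSemidef.trace_nonneg
    have h1 : W.det ≤ x * (1 + 1 * W.trace) ^ (d - 1) := by
      refine (hW.det_le_eig_mul ⟨0, hd⟩).trans ?_
      have hWx' : eig W ⟨0, hd⟩ < x := hWx
      gcongr
      linarith
    have hone : 1 ≤ (1 + 1 * W.trace) ^ (d - 1) := one_le_pow₀ (by linarith)
    have h2 : W.det ^ a ≤ x ^ a * (C * Real.exp (c / 2 * W.trace)) := by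
      calc W.det ^ a ≤ (x * (1 + 1 * W.trace) ^ (d - 1)) ^ a :=
            Real.rpow_le_rpow hdet.le h1 ha.le
        _ = x ^ a * ((1 + 1 * W.trace) ^ (d - 1)) ^ a := Real.mul_rpow hx.le (by positivity)
        _ ≤ x ^ a * ((1 + 1 * W.trace) ^ (d - 1)) ^ (1 : ℝ) := by gcongr
        _ ≤ _ := by
          rw [Real.rpow_one]
          exact mul_le_mul_of_nonneg_left (hC _ htr) hxa.le
    have h3 : W.det ^ α = W.det ^ (α - a) * W.det ^ a := by
      rw [← Real.rpow_add hdet]; congr 1; ring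
    have h4 : Real.exp (-(c / 2) * W.trace) =
        Real.exp (c / 2 * W.trace) * Real.exp (-c * W.trace) := by
      rw [← Real.exp_add]; congr 1; ring
    have h5 : 0 ≤ W.det ^ (α - a) := Real.rpow_nonneg hdet.le _
    rw [h3, h4]
    calc _ = W.det ^ (α - a) * Real.exp (-c * W.trace) * W.det ^ a := by ring
      _ ≤ W.det ^ (α - a) * Real.exp (-c * W.trace) *
          (x ^ a * (C * Real.exp (c / 2 * W.trace))) :=
        mul_le_mul_of_nonneg_left h2 (by positivity)
      _ = _ := by ring
  · rw [hI, ← ENNReal.ofReal_mul (by positivity)]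
    apply ENNReal.ofReal_le_ofReal
    nlinarith

/-! ### Perturbation of ordered eigenvalues -/

/-- Min-max comparison of two diagonalised quadratic forms. -/
theorem le_add_of_quadratic_le {d : ℕ} (Y Z : (Fin d → ℝ) →ₗ[ℝ] (Fin d → ℝ))
    (hY : ∀ x, ∑ k, Y x k ^ 2 = ∑ k, x k ^ 2) (hZ : ∀ x, ∑ k, Z x k ^ 2 = ∑ k, x k ^ 2)
    {l m : Fin d → ℝ} (hl : Monotone l) (hm : Monotone m) {η : ℝ}
    (h : ∀ x, ∑ k, l k * Y x k ^ 2 ≤ ∑ k, m k * Z x k ^ 2 + η * ∑ k, x k ^ 2) (j : Fin d) :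
    l j ≤ m j + η := by
  -- These are `d - 1` linear conditions, so some `x ≠ 0` has vanishing `Y`-coordinates below `j`
  -- and `Z`-coordinates above `j`. On it the first form is at least `l j * |x|²` and the second at
  -- most `m j * |x|²`.
  let L : (Fin d → ℝ) →ₗ[ℝ] ({k : Fin d // k ≠ j} → ℝ) :=
    LinearMap.pi fun k =>
      if k.1 < j then LinearMap.proj k.1 ∘ₗ Y else LinearMap.proj k.1 ∘ₗ Z
  have hrank : Module.finrank ℝ ({k : Fin d // k ≠ j} → ℝ) < Module.finrank ℝ (Fin d → ℝ) := by
    rw [Module.finrank_fintype_fun_eq_card, Module.finrank_fintype_fun_eq_card]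
    exact Fintype.card_subtype_lt (x := j) (by simp)
  obtain ⟨x, hx, hx0⟩ := Submodule.exists_mem_ne_zero_of_ne_bot
    (LinearMap.ker_ne_bot_of_finrank_lt (f := L) hrank)
  have hLx : ∀ k (hk : k ≠ j), L x ⟨k, hk⟩ = 0 := fun k hk => by
    rw [LinearMap.mem_ker.1 hx]; rfl
  have hYx : ∀ k, k < j → Y x k = 0 := by
    intro k hk
    simpa [L, hk] using hLx k hk.ne
  have hZx : ∀ k, j < k → Z x k = 0 := by
    intro k hk
    simpa [L, hk.not_gt] using hLx k hk.ne'
  have hpos : 0 < ∑ k, x k ^ 2 := by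
    obtain ⟨k, hk⟩ := Function.ne_iff.1 hx0
    exact Finset.sum_pos' (fun _ _ => sq_nonneg _) ⟨k, Finset.mem_univ k, by
      have : x k ≠ 0 := hk
      positivity⟩
  have h1 : l j * ∑ k, x k ^ 2 ≤ ∑ k, l k * Y x k ^ 2 := by
    rw [← hY, Finset.mul_sum]
    refine Finset.sum_le_sum fun k _ => ?_
    rcases lt_or_ge k j with hk | hk
    · simp [hYx k hk]
    · exact mul_le_mul_of_nonneg_right (hl hk) (sq_nonneg _)
  have h2 : ∑ k, m k * Z x k ^ 2 ≤ m j * ∑ k, x k ^ 2 := by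
    rw [← hZ, Finset.mul_sum]
    refine Finset.sum_le_sum fun k _ => ?_
    rcases le_or_gt k j with hk | hk
    · exact mul_le_mul_of_nonneg_right (hm hk) (sq_nonneg _)
    · simp [hZx k hk]
  have h3 := h x
  nlinarith

theorem exists_diagonalising_coordinates {d : ℕ} {A : Matrix (Fin d) (Fin d) ℝ}
    (hA : A.IsHermitian) : ∃ Y : (Fin d → ℝ) →ₗ[ℝ] (Fin d → ℝ),
      (∀ x, ∑ k, Y x k ^ 2 = ∑ k, x k ^ 2) ∧
      ∀ x, x ⬝ᵥ A.mulVec x = ∑ k, eig A k * Y x k ^ 2 := by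
  obtain ⟨σ, hσ⟩ := exists_equiv_eig_eq_eigenvalues hA
  obtain ⟨U, hU⟩ : ∃ U : Matrix (Fin d) (Fin d) ℝ, U = hA.eigenvectorUnitary := ⟨_, rfl⟩
  have hUU : U * U.transpose = 1 := by
    have := Unitary.coe_mul_star_self hA.eigenvectorUnitary
    rwa [Unitary.coe_star, ← hU, Matrix.star_eq_conjTranspose, Matrix.conjTranspose_eq_transpose_of_trivial] at this
  have hsp : A = U * Matrix.diagonal hA.eigenvalues * U.transpose := by
    conv_lhs => rw [hA.spectral_theorem]
    rw [Unitary.conjStarAlgAut_apply, ← hU, Matrix.star_eq_conjTranspose,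
      Matrix.conjTranspose_eq_transpose_of_trivial]
    rfl
  refine ⟨(LinearMap.funLeft ℝ ℝ σ).comp U.transpose.mulVecLin, fun x => ?_, fun x => ?_⟩
  · have h1 : ∑ k, (U.transpose.mulVec x) k ^ 2 =
        U.transpose.mulVec x ⬝ᵥ U.transpose.mulVec x := by simp [dotProduct, sq]
    have h2 : ∑ k, x k ^ 2 = x ⬝ᵥ x := by simp [dotProduct, sq]
    simp only [LinearMap.comp_apply, LinearMap.funLeft_apply, Matrix.mulVecLin_apply]
    rw [Equiv.sum_comp σ fun k => (U.transpose.mulVec x) k ^ 2, h1, h2,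
      Matrix.dotProduct_mulVec, Matrix.vecMul_transpose, Matrix.mulVec_mulVec, hUU,
      Matrix.one_mulVec]
  · simp only [LinearMap.comp_apply, LinearMap.funLeft_apply, Matrix.mulVecLin_apply, hσ]
    rw [Equiv.sum_comp σ fun k => hA.eigenvalues k * (U.transpose.mulVec x) k ^ 2]
    conv_lhs => rw [hsp]
    rw [← Matrix.mulVec_mulVec, ← Matrix.mulVec_mulVec, Matrix.dotProduct_mulVec,
      ← Matrix.mulVec_transpose]
    simp only [dotProduct, Matrix.mulVec_diagonal]
    exact Finset.sum_congr rfl fun k _ => by ring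

/-- Weyl's inequality: by Cauchy–Schwarz the quadratic form of the difference is at most `ε * (∑ |x
i|) ^ 2 ≤ ε * d * |x|²`, and min-max applies in both directions. -/
theorem abs_eig_sub_le {d : ℕ} {A : Matrix (Fin d) (Fin d) ℝ} (hA : A.IsHermitian)
    {m : Fin d → ℝ} (hm : Monotone m) {ε : ℝ}
    (h : ∀ i j, |A i j - Matrix.diagonal m i j| ≤ ε) (j : Fin d) :
    |eig A j - m j| ≤ ε * d := by
  have hε : 0 ≤ ε := (abs_nonneg _).trans (h j j)
  obtain ⟨Y, hY, hYA⟩ := exists_diagonalising_coordinates hA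
  have hdiff : ∀ x : Fin d → ℝ,
      |∑ k, eig A k * Y x k ^ 2 - ∑ k, m k * x k ^ 2| ≤ ε * d * ∑ k, x k ^ 2 := by
    intro x
    have h1 : ∑ k, m k * x k ^ 2 = x ⬝ᵥ (Matrix.diagonal m).mulVec x := by
      simp only [dotProduct, Matrix.mulVec_diagonal]
      exact Finset.sum_congr rfl fun k _ => by ring
    rw [← hYA, h1, ← dotProduct_sub, ← Matrix.sub_mulVec]
    simp only [dotProduct, Matrix.mulVec, Finset.mul_sum, Matrix.sub_apply]
    calc |∑ i, ∑ k, x i * ((A i k - Matrix.diagonal m i k) * x k)|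
        ≤ ∑ i, ∑ k, |x i * ((A i k - Matrix.diagonal m i k) * x k)| :=
          (Finset.abs_sum_le_sum_abs _ _).trans
            (Finset.sum_le_sum fun i _ => Finset.abs_sum_le_sum_abs _ _)
      _ ≤ ∑ i, ∑ k, |x i| * (ε * |x k|) := by
          refine Finset.sum_le_sum fun i _ => Finset.sum_le_sum fun k _ => ?_
          rw [abs_mul, abs_mul]
          have := h i k
          gcongr
      _ = ε * (∑ i, |x i|) ^ 2 := by
          rw [sq, Finset.sum_mul_sum, Finset.mul_sum]
          refine Finset.sum_congr rfl fun i _ => ?_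
          rw [Finset.mul_sum]
          exact Finset.sum_congr rfl fun k _ => by ring
      _ ≤ ε * (d * ∑ i, |x i| ^ 2) := by
          refine mul_le_mul_of_nonneg_left ?_ hε
          simpa using sq_sum_le_card_mul_sum_sq (s := Finset.univ) (f := fun i => |x i|)
      _ = _ := by simp [mul_assoc, Finset.mul_sum]
  have hI : ∀ x : Fin d → ℝ,
      ∑ k, (LinearMap.id (R := ℝ) (M := Fin d → ℝ)) x k ^ 2 = ∑ k, x k ^ 2 := fun x => rfl
  rw [abs_le]
  constructor
  · have := le_add_of_quadratic_le LinearMap.id Y hI hY hm (monotone_eig A) (η := ε * d)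
      (fun x => by have := (abs_le.1 (hdiff x)).1; simp only [LinearMap.id_apply]; linarith) j
    linarith
  · have := le_add_of_quadratic_le Y LinearMap.id hY hI (monotone_eig A) hm (η := ε * d)
      (fun x => by have := (abs_le.1 (hdiff x)).2; simp only [LinearMap.id_apply]; linarith) j
    linarith

/-! ### Small-ball lower bound -/

/-- Lower bound for inverse-Wishart probabilities from a small box of matrices. -/
theorem ofReal_mul_le_invWishart {d : ℕ} {ν : ℝ} {Ψ : Matrix (Fin d) (Fin d) ℝ}
    (A : Set (Matrix (Fin d) (Fin d) ℝ)) (D : Matrix (Fin d) (Fin d) ℝ) {ε k : ℝ} (hε : 0 < ε)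
    (hk : 0 ≤ k) (hD : D.IsHermitian)
    (h : ∀ W : Matrix (Fin d) (Fin d) ℝ, W.IsHermitian → (∀ i j, |W i j - D i j| ≤ ε) →
      W.PosDef ∧ W ∈ A ∧ k ≤ wishartDensity ν Ψ⁻¹ W) :
    ENNReal.ofReal (k * (2 * ε) ^ Fintype.card {p : Fin d × Fin d // p.1 ≤ p.2}) ≤
      invWishart ν Ψ {S | S⁻¹ ∈ A} := by
  set R : Set (Matrix (Fin d) (Fin d) ℝ) :=
    {W | W.PosDef} ∩ ⋂ (i : Fin d) (j : Fin d), {W | |W i j - D i j| ≤ ε}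
  have hherm : ∀ i j, D i j = D (min i j) (max i j) := by
    intro i j
    rcases le_total i j with hij | hij
    · simp [hij]
    · simpa [hij] using hD.apply j i
  have hR : MeasurableSet R := by
    refine measurableSet_posDef.inter (MeasurableSet.iInter fun i => MeasurableSet.iInter fun j => ?_)
    have hc : Continuous fun W : Matrix (Fin d) (Fin d) ℝ => |W i j - D i j| :=
      ((continuous_id.matrix_elem i j).sub continuous_const).abs
    exact (isClosed_le hc continuous_const).measurableSet
  have hRA : ∀ W ∈ R, W.PosDef ∧ W ∈ A ∧ k ≤ wishartDensity ν Ψ⁻¹ W := by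
    rintro W ⟨hW, hWD⟩
    exact h W hW.1 fun i j => by simpa using Set.mem_iInter.1 (Set.mem_iInter.1 hWD i) j
  have hball : Metric.ball (fun p : {p : Fin d × Fin d // p.1 ≤ p.2} => D p.1.1 p.1.2) ε ⊆
      symOfUpper ⁻¹' R := by
    intro u hu
    have hu' : ∀ i j, |symOfUpper u i j - D i j| ≤ ε := by
      intro i j
      have := (dist_pi_lt_iff hε).1 hu ⟨(min i j, max i j), min_le_max⟩
      rw [Real.dist_eq] at this
      rw [hherm i j]
      exact this.le
    exact ⟨(h _ (isHermitian_symOfUpper u) hu').1,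
      Set.mem_iInter.2 fun i => Set.mem_iInter.2 fun j => hu' i j⟩
  have hsub : R ⊆ (fun W : Matrix (Fin d) (Fin d) ℝ => W⁻¹) ⁻¹' {S | S⁻¹ ∈ A} := by
    intro W hW
    have := hRA W hW
    simpa [Matrix.nonsing_inv_nonsing_inv _ this.1.det_pos.ne'.isUnit] using this.2.1
  calc _ = ENNReal.ofReal k * volume
        (Metric.ball (fun p : {p : Fin d × Fin d // p.1 ≤ p.2} => D p.1.1 p.1.2) ε) := by
        rw [Real.volume_pi_ball _ hε, ENNReal.ofReal_mul hk]
    _ ≤ ENNReal.ofReal k * symLebesgue d R := by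
        rw [symLebesgue, Measure.map_apply measurable_symOfUpper hR]
        gcongr
    _ = ∫⁻ _W in R, ENNReal.ofReal k ∂symLebesgue d := by simp
    _ ≤ ∫⁻ W in R, ENNReal.ofReal (wishartDensity ν Ψ⁻¹ W) ∂symLebesgue d :=
        setLIntegral_mono' hR fun W hW => ENNReal.ofReal_le_ofReal (hRA W hW).2.2
    _ = wishart ν Ψ⁻¹ R := by rw [wishart, withDensity_apply _ hR]
    _ ≤ wishart ν Ψ⁻¹ ((fun W => W⁻¹) ⁻¹' {S | S⁻¹ ∈ A}) := measure_mono hsub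
    -- This direction holds for arbitrary sets, so `A` needs no measurability.
    _ ≤ _ := Measure.le_map_apply measurable_matrix_inv.aemeasurable _

theorem trace_mul_le_of_abs_le {d : ℕ} (P W : Matrix (Fin d) (Fin d) ℝ) {r : ℝ}
    (hW : ∀ i j, |W i j| ≤ r) : (P * W).trace ≤ (∑ i, ∑ j, |P i j|) * r := by
  simp only [Matrix.trace, Matrix.diag, Matrix.mul_apply, Finset.sum_mul]
  refine Finset.sum_le_sum fun i _ => Finset.sum_le_sum fun j _ => ?_
  calc P i j * W j i ≤ |P i j * W j i| := le_abs_self _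
    _ = |P i j| * |W j i| := abs_mul _ _
    _ ≤ |P i j| * r := mul_le_mul_of_nonneg_left (hW j i) (abs_nonneg _)

/-- A power of a number trapped between `p ^ d` and `(2 * S) ^ d`. -/
theorem exists_le_rpow_of_mem_Icc (d : ℕ) {α : ℝ} (hα : -1 < α) :
    ∃ C : ℝ, 0 < C ∧ ∀ p S D : ℝ, 0 < p → p ≤ S → p ^ d ≤ D → D ≤ (2 * S) ^ d →
      C * p ^ (d * max α 0) * Real.exp (-S) ≤ D ^ α := by
  obtain ⟨C, hC0, hC⟩ := exists_one_add_mul_pow_le_exp d (k := 2) (δ := 1) zero_le_two one_pos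
  refine ⟨min 1 C⁻¹, lt_min one_pos (inv_pos.2 hC0), fun p S D hp hpS hD1 hD2 => ?_⟩
  have hS : 0 < S := hp.trans_le hpS
  have hD : 0 < D := (pow_pos hp d).trans_le hD1
  rcases le_total 0 α with h | h
  · rw [max_eq_left h, Real.rpow_mul hp.le, Real.rpow_natCast]
    have h1 : (p ^ d) ^ α ≤ D ^ α := Real.rpow_le_rpow (by positivity) hD1 h
    have h2 : Real.exp (-S) ≤ 1 := Real.exp_le_one_iff.2 (by linarith)
    have h3 : 0 ≤ (p ^ d) ^ α := by positivity
    have h4 : min 1 C⁻¹ * (p ^ d) ^ α ≤ (p ^ d) ^ α :=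
      mul_le_of_le_one_left h3 (min_le_left _ _)
    exact ((mul_le_of_le_one_right (by positivity) h2).trans h4).trans h1
  · rw [max_eq_right h, mul_zero, Real.rpow_zero, mul_one]
    have h1 : D ≤ (1 + 2 * S) ^ d := hD2.trans (pow_le_pow_left₀ (by positivity) (by linarith) d)
    have h2 : D ^ (-α) ≤ C * Real.exp S := by
      calc D ^ (-α) ≤ ((1 + 2 * S) ^ d) ^ (-α) := Real.rpow_le_rpow hD.le h1 (by linarith)
        -- Here `α > -1` enters, as `-α ≤ 1`.
        _ ≤ ((1 + 2 * S) ^ d) ^ (1 : ℝ) := Real.rpow_le_rpow_of_exponent_le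
            (one_le_pow₀ (by linarith)) (by linarith)
        _ ≤ C * Real.exp S := by simpa using hC S hS.le
    have h3 : D ^ α = (D ^ (-α))⁻¹ := by rw [Real.rpow_neg hD.le, inv_inv]
    rw [h3]
    calc min 1 C⁻¹ * Real.exp (-S) ≤ C⁻¹ * Real.exp (-S) :=
          mul_le_mul_of_nonneg_right (min_le_right _ _) (Real.exp_pos _).le
      _ = (C * Real.exp S)⁻¹ := by rw [Real.exp_neg, mul_inv]
      _ ≤ _ := inv_anti₀ (Real.rpow_pos_of_pos hD _) h2

theorem eigSmallBall_invWishart {d : ℕ} (hd : 0 < d) {ν : ℝ} (hν : (d : ℝ) - 1 < ν)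
    {Ψ : Matrix (Fin d) (Fin d) ℝ} (hΨ : Ψ.PosDef) : EigSmallBall hd 2 (invWishart ν Ψ) := by
  obtain ⟨K, hK, hdens⟩ := exists_wishartDensity_eq hν hΨ
  set α := (ν - (d : ℝ) - 1) / 2
  have hα : -1 < α := by simp only [α]; linarith
  obtain ⟨C, hC, hCdet⟩ := exists_le_rpow_of_mem_Icc d hα
  set N := Fintype.card {p : Fin d × Fin d // p.1 ≤ p.2}
  have hN : 0 < N := Fintype.card_pos_iff.2 ⟨⟨(⟨0, hd⟩, ⟨0, hd⟩), le_rfl⟩⟩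
  have hd' : (0 : ℝ) < d := by exact_mod_cast hd
  have hN' : (0 : ℝ) < N := by exact_mod_cast hN
  set P : ℝ := ∑ i, ∑ j, |Ψ i j|
  have hP : 0 ≤ P := Finset.sum_nonneg fun i _ => Finset.sum_nonneg fun j _ => abs_nonneg _
  -- The box volume `(2 * ε) ^ N` supplies `s_1 ^ N * t ^ N`, and the determinant supplies `s_1 ^ (d
  -- * max α 0)`. In the exponent, `P` pays for `tr (Ψ W) / 2` and `1` for the determinant.
  refine ⟨N + d * max α 0, N, K * C * (1 / (2 * d)) ^ N, P + 1, by positivity, hN',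
    by positivity, by positivity, fun s hs hmono t ht ht1 => ?_⟩
  set p := s ⟨0, hd⟩ with hp_def
  set S := s ⟨d - 1, Nat.sub_one_lt_of_lt hd⟩ with hS_def
  have hp : 0 < p := hs _
  have hps : ∀ j, p ≤ s j := fun j => hmono (Fin.le_def.2 (Nat.zero_le _))
  have hsS : ∀ j, s j ≤ S := fun j => hmono (Fin.le_def.2 (Nat.le_sub_one_of_lt j.2))
  have hpS : p ≤ S := hps _
  have hS : 0 < S := hp.trans_le hpS
  -- Eigenvalues then move by at most `p * t / 4`, less than the distance `s j * t / 2` from each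
  -- centre to the ends of its interval.
  set ε := p * t / (4 * d) with hε_def
  have hε : 0 < ε := by positivity
  have hεd : ε * d = p * t / 4 := by rw [hε_def]; field_simp
  have hm : Monotone fun j => s j * (1 + t / 2) := fun i j hij =>
    mul_le_mul_of_nonneg_right (hmono hij) (by linarith)
  refine le_trans (le_of_eq ?_) (ofReal_mul_le_invWishart
    {W | ∀ j, s j < eig W j ∧ eig W j < s j * (1 + t)}
    (Matrix.diagonal fun j => s j * (1 + t / 2)) (ε := ε)
    (k := K * (C * p ^ (d * max α 0) * Real.exp (-S) * Real.exp (-(P * S)))) hε (by positivity)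
    (Matrix.isHermitian_diagonal _) fun W hW hWD => ?_)
  · congr 1
    have e1 : p ^ ((N : ℝ) + d * max α 0) = p ^ N * p ^ (d * max α 0) := by
      rw [Real.rpow_add hp, Real.rpow_natCast]
    have e2 : Real.exp (-(P + 1) * S ^ ((2 : ℝ) / 2)) =
        Real.exp (-S) * Real.exp (-(P * S)) := by
      rw [div_self two_ne_zero, Real.rpow_one, ← Real.exp_add]; congr 1; ring
    have e3 : 2 * ε = 1 / (2 * d) * p * t := by rw [hε_def]; field_simp; norm_num
    rw [e1, e2, e3, Real.rpow_natCast, mul_pow, mul_pow]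
    ring
  · have heig : ∀ j, s j < eig W j ∧ eig W j < s j * (1 + t) := by
      intro j
      have h1 := abs_le.1 (abs_eig_sub_le hW hm hWD j)
      rw [hεd] at h1
      have h2 := mul_le_mul_of_nonneg_right (hps j) ht.le
      have h3 := mul_pos (hs j) ht
      constructor <;> linarith [h1.1, h1.2]
    have hpd : W.PosDef := (posDef_iff_eig_pos hW).2 fun j => (hs j).trans (heig j).1
    refine ⟨hpd, heig, ?_⟩
    have hdet1 : p ^ d ≤ W.det := by
      rw [det_eq_prod_eig hW]
      calc p ^ d = ∏ _j : Fin d, p := by simp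
        _ ≤ _ := Finset.prod_le_prod (fun _ _ => hp.le) fun j _ => (hps j).trans (heig j).1.le
    have hdet2 : W.det ≤ (2 * S) ^ d := by
      rw [det_eq_prod_eig hW]
      calc _ ≤ ∏ _j : Fin d, 2 * S := Finset.prod_le_prod
            (fun j _ => ((hs j).trans (heig j).1).le) fun j _ => by
              nlinarith [(heig j).2, hsS j, hs j]
        _ = _ := by simp
    have hεS : ε ≤ S / 4 := by
      have : ε ≤ ε * d := le_mul_of_one_le_right hε.le (by exact_mod_cast hd)
      rw [hεd] at this
      nlinarith
    have hWle : ∀ i j, |W i j| ≤ 2 * S := by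
      intro i j
      have h1 := hWD i j
      have h2 : |Matrix.diagonal (fun j => s j * (1 + t / 2)) i j| ≤ 3 / 2 * S := by
        rcases eq_or_ne i j with rfl | hij
        · rw [Matrix.diagonal_apply_eq, abs_of_pos (mul_pos (hs i) (by linarith))]
          nlinarith [hsS i, hs i]
        · rw [Matrix.diagonal_apply_ne _ hij, abs_zero]; positivity
      have h3 := abs_sub_abs_le_abs_sub (W i j) (Matrix.diagonal (fun j => s j * (1 + t / 2)) i j)
      linarith
    have htr := trace_mul_le_of_abs_le Ψ W hWle
    rw [hdens W hpd]
    refine mul_le_mul_of_nonneg_left ?_ hK.le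
    refine mul_le_mul (hCdet p S W.det hp hpS hdet1 hdet2) (Real.exp_le_exp.2 ?_)
      (Real.exp_pos _).le (Real.rpow_nonneg hpd.det_pos.le _)
    linarith

end

theorem lemma1 (d : ℕ) (hd : 0 < d) (ν : ℝ) (hν : (d : ℝ) - 1 < ν)
    (Ψ : Matrix (Fin d) (Fin d) ℝ) (hΨ : Ψ.PosDef) :
    LargestEigTail hd (invWishart ν Ψ) ∧
      SmallestEigTail hd (invWishart ν Ψ) ∧
      EigSmallBall hd 2 (invWishart ν Ψ) := by
  exact ⟨largestEigTail_invWishart hd hν hΨ, smallestEigTail_invWishart hd hν hΨ,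
    eigSmallBall_invWishart hd hν hΨ⟩
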